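/- Let $k$ be a commutative ring and $R$ a $k$-algebra (associative, unital, not necessarily commutative). Let $A$ be an $R$-ring, i.e. a $k$-algebra with a $k$-algebra map $\eta\colon R\to A$, regarded as an $R$-$R$ bimodule through $\eta$, and let $C$ be an $R$-coring with comultiplication $\Delta$ and counit $\varepsilon$ (a comonoid in the category of $R$-$R$ bimodules on which the two actions of $k$ coincide). Let $(A,C,\psi)_R$ be a bijective right entwining structure: $\psi\colon C\otimes_R A\to A\otimes_R C$ is a bijective $R$-$R$ bimodule map such that $\psi(C\otimes\mu_A)=(\mu_A\otimes C)(A\otimes\psi)(\psi\otimes A)$, $\psi(C\otimes\eta)=\eta\otimes C$, $(A\otimes\Delta)\psi=(\psi\otimes C)(C\otimes\psi)(\Delta\otimes A)$ and $(A\otimes\varepsilon)\psi=\varepsilon\otimes A$. Let $\varrho\colon A\to A\otimes_R C$ be a right $C$-coaction making $A$, with right multiplication, an entwined module, i.e. $\varrho(aa')=(\mu_A\otimes C)(A\otimes\psi)(\varrho(a)\otimes a')$. Let $B=\{b\in A:\varrho(ba)=b\varrho(a)\text{ for all }a\in A\}$ be the subalgebra of coinvariants (so $B\subseteq A$ is an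 entwined extension), and give $A$ the left coaction ${}^A\!\varrho(a)=\psi^{-1}(a\varrho(1))\in C\otimes_R A$. Let $T$ be a $k$-subalgebra of $B$. Assume that 1. there is a $B$-$T$ bimodule map $\phi\colon A\to B$ with $\phi(b)=b$ for all $b\in B$; 2. $A$ is locally projective as a right $T$-module: for every finitely generated submodule $X\subseteq A$ there are finitely many $x_p\in A$ and $\xi_p\in\mathrm{Hom}_{-T}(A,T)$ with $x=\sum_p x_p\xi_p(x)$ for all $x\in X$; 3. $A$ is flat as a left $T$-module; 4. there is a strong $T$-connection $\ell\colon C\to A\otimes_T A$, i.e. a map which is both a left and a right $C$-comodule map (for the coactions ${}^A\!\varrho\otimes_T A$ and $A\otimes_T\varrho$), and satisfies $\widetilde{\mathrm{can}}_T(\ell(c))=1\otimes_R c$ for all $c\in C$, where $\widetilde{\mathrm{can}}_T(a\otimes_T a')=a\varrho(a')$. Let $W$ be a left $C$-comodule that is finitely generated and projective as a left $R$-module, with finite dual basis $\{w_i\in W,\ \chi_i\in\mathrm{Hom}_{R-}(W,R)\}_{i\in I}$, and let $e_{ij}=(C\otimes_R\chi_j)({}^W\!\varrho(w_i))\in C$.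 Write $\ell(e_{ij})=\sum_{\nu=1}^n y_{ij\nu}\otimes_T y'_{ij\nu}$, let $X$ be the right $T$-submodule of $A$ generated by all $y_{ij\nu}$, and let $\{x_p\in A,\ \xi_p\in\mathrm{Hom}_{-T}(A,T)\}_{p\in P}$ be any finite family with $x=\sum_p x_p\xi_p(x)$ for all $x\in X$. Put $\ell_p=(\xi_p\otimes_T A)\circ\ell\colon C\to A$ and $$E_{(i,p),(j,q)}=\phi(\ell_p(e_{ij})\,x_q)\in B,\qquad (i,p),(j,q)\in I\times P .$$ Then each $\ell_p$ is a right $C$-comodule map, the matrix $E$ is idempotent, and the cotensor product $A\,\square_C W=\{z\in A\otimes_R W:(\varrho\otimes_R W)(z)=(A\otimes_R{}^W\!\varrho)(z)\}$ is isomorphic, as a left $B$-module, to $B^{(I\times P)}E$, the left $B$-module of all row vectors $vE$ with $v\in B^{(I\times P)}$. -/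

import Mathlib

open MulOpposite

universe uk uR uA uC uW uI uP

/-! ## Tensor products over a noncommutative ring

A right module over `S` is a module over `Sᵐᵒᵖ`: the element `m · s` is `op s • m`. -/

/-- The relations `m·s ⊗ n = m ⊗ s·n`, inside the tensor product of abelian groups. -/
def NCTensor.rel (S M N : Type*) [Ring S] [AddCommGroup M] [AddCommGroup N]
    [Module Sᵐᵒᵖ M] [Module S N] : AddSubgroup (TensorProduct ℤ M N) :=
  AddSubgroup.closure
    {z | ∃ (m : M) (s : S) (n : N),
      z = TensorProduct.tmul ℤ (op s • m) n - TensorProduct.tmul ℤ m (s • n)}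

/-- The tensor product `M ⊗_S N` of a right `S`-module `M` and a left `S`-module `N` over a
(not necessarily commutative) ring `S`. -/
def NCTensor (S M N : Type*) [Ring S] [AddCommGroup M] [AddCommGroup N]
    [Module Sᵐᵒᵖ M] [Module S N] : Type _ :=
  TensorProduct ℤ M N ⧸ NCTensor.rel S M N

namespace NCTensor

section basic

variable {S M N P : Type*} [Ring S] [AddCommGroup M] [AddCommGroup N] [AddCommGroup P]
  [Module Sᵐᵒᵖ M] [Module S N]

instance : AddCommGroup (NCTensor S M N) :=
  inferInstanceAs (AddCommGroup (TensorProduct ℤ M N ⧸ NCTensor.rel S M N))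

variable (S M N) in
/-- The projection from the tensor product of abelian groups. -/
def mk : TensorProduct ℤ M N →+ NCTensor S M N := QuotientAddGroup.mk' (NCTensor.rel S M N)

variable (S) in
/-- The pure tensor `m ⊗_S n`. -/
def tmul (m : M) (n : N) : NCTensor S M N := mk S M N (TensorProduct.tmul ℤ m n)

theorem tmul_add (m : M) (n n' : N) : tmul S m (n + n') = tmul S m n + tmul S m n' := by
  rw [tmul, TensorProduct.tmul_add, map_add]; rfl

theorem add_tmul (m m' : M) (n : N) : tmul S (m + m') n = tmul S m n + tmul S m' n := by
  rw [tmul, TensorProduct.add_tmul, map_add]; rfl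

@[simp] theorem tmul_zero (m : M) : tmul S m (0 : N) = 0 := by
  rw [tmul, TensorProduct.tmul_zero, map_zero]

@[simp] theorem zero_tmul (n : N) : tmul S (0 : M) n = 0 := by
  rw [tmul, TensorProduct.zero_tmul, map_zero]

theorem tmul_balanced (m : M) (s : S) (n : N) : tmul S (op s • m) n = tmul S m (s • n) := by
  rw [← sub_eq_zero, tmul, tmul, ← map_sub]
  exact (QuotientAddGroup.eq_zero_iff _).2 (AddSubgroup.subset_closure ⟨m, s, n, rfl⟩)

/-- The universal property: additive maps out of `M ⊗_S N` from balanced biadditive maps. -/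
def lift (f : M →+ N →+ P) (hf : ∀ m (s : S) n, f (op s • m) n = f m (s • n)) :
    NCTensor S M N →+ P :=
  QuotientAddGroup.lift (NCTensor.rel S M N)
    (TensorProduct.liftAddHom f (fun r m n => by simp))
    (by
      rw [NCTensor.rel, AddSubgroup.closure_le]
      rintro z ⟨m, s, n, rfl⟩
      simp [hf])

@[simp] theorem lift_tmul (f : M →+ N →+ P) (hf) (m : M) (n : N) :
    lift (S := S) f hf (tmul S m n) = f m n := rfl

theorem induction_on {p : NCTensor S M N → Prop} (z : NCTensor S M N)
    (h0 : p 0) (ht : ∀ m n, p (tmul S m n)) (ha : ∀ x y, p x → p y → p (x + y)) : p z := by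
  obtain ⟨z, rfl⟩ : ∃ y, mk S M N y = z := QuotientAddGroup.mk'_surjective _ z
  induction z with
  | zero => rw [map_zero]; exact h0
  | tmul m n => exact ht m n
  | add x y hx hy => rw [map_add]; exact ha _ _ hx hy

theorem hom_ext {f g : NCTensor S M N →+ P} (h : ∀ m n, f (tmul S m n) = g (tmul S m n)) :
    f = g := by
  ext z
  induction z using induction_on with
  | h0 => simp
  | ht m n => exact h m n
  | ha x y hx hy => simp [hx, hy]

variable {M' N' : Type*} [AddCommGroup M'] [AddCommGroup N'] [Module Sᵐᵒᵖ M'] [Module S N']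

/-- The map `f ⊗_S g`. -/
def map (f : M →ₗ[Sᵐᵒᵖ] M') (g : N →ₗ[S] N') : NCTensor S M N →+ NCTensor S M' N' :=
  lift
    (AddMonoidHom.mk' (fun m => AddMonoidHom.mk' (fun n => tmul S (f m) (g n))
        (fun n n' => by rw [map_add, tmul_add]))
      (fun m m' => by ext n; simp [add_tmul]))
    (fun m s n => by simp [tmul_balanced])

@[simp] theorem map_tmul (f : M →ₗ[Sᵐᵒᵖ] M') (g : N →ₗ[S] N') (m : M) (n : N) :
    map f g (tmul S m n) = tmul S (f m) (g n) := rfl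

/-- `M ⊗_S χ` for a left `S`-linear functional `χ`, followed by `M ⊗_S S ≃ M`:
`m ⊗ n ↦ m · χ n`. -/
def contractRight (χ : N →ₗ[S] S) : NCTensor S M N →+ M :=
  lift
    (AddMonoidHom.mk' (fun m => AddMonoidHom.mk' (fun n => op (χ n) • m)
        (fun n n' => by rw [map_add, op_add, add_smul]))
      (fun m m' => by ext n; simp))
    (fun m s n => by simp [mul_smul])

@[simp] theorem contractRight_tmul (χ : N →ₗ[S] S) (m : M) (n : N) :
    contractRight χ (tmul S m n) = op (χ n) • m := rfl

/-- `ξ ⊗_S N` for a right `S`-linear functional `ξ`, followed by `S ⊗_S N ≃ N`: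
`m ⊗ n ↦ ξ m · n`. -/
def contractLeft (ξ : M →ₗ[Sᵐᵒᵖ] S) : NCTensor S M N →+ N :=
  lift
    (AddMonoidHom.mk' (fun m => AddMonoidHom.mk' (fun n => ξ m • n)
        (fun n n' => by rw [smul_add]))
      (fun m m' => by ext n; simp [add_smul]))
    (fun m s n => by simp [mul_smul])

@[simp] theorem contractLeft_tmul (ξ : M →ₗ[Sᵐᵒᵖ] S) (m : M) (n : N) :
    contractLeft ξ (tmul S m n) = ξ m • n := rfl

end basic

section modules

variable {L S Q M N : Type*} [Ring L] [Ring S] [Ring Q] [AddCommGroup M] [AddCommGroup N]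
  [Module Sᵐᵒᵖ M] [Module S N]

/-- The left `L`-module `M ⊗_S N` for an `L`-`S` bimodule `M`. -/
instance leftModule [Module L M] [SMulCommClass L Sᵐᵒᵖ M] : Module L (NCTensor S M N) where
  smul l := map
    { toFun := fun m => l • m, map_add' := smul_add l,
      map_smul' := fun s m => smul_comm l s m } LinearMap.id
  one_smul z := by
    induction z using induction_on with
    | h0 => exact map_zero _
    | ht m n => exact congrArg (tmul S · n) (one_smul L m)
    | ha x y hx hy => exact (map_add _ _ _).trans (congrArg₂ (· + ·) hx hy)
  mul_smul l l' z := by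
    induction z using induction_on with
    | h0 => exact (map_zero _).trans ((congrArg _ (map_zero _)).trans (map_zero _)).symm
    | ht m n => exact congrArg (tmul S · n) (mul_smul l l' m)
    | ha x y hx hy =>
      exact (map_add _ _ _).trans ((congrArg₂ (· + ·) hx hy).trans
        ((congrArg _ (map_add _ _ _)).trans (map_add _ _ _)).symm)
  smul_zero l := map_zero _
  smul_add l := map_add _
  add_smul l l' z := by
    induction z using induction_on with
    | h0 =>
      refine (map_zero _).trans ?_
      exact ((congrArg₂ (· + ·) (map_zero _) (map_zero _)).trans (add_zero _)).symm
    | ht m n => exact (congrArg (tmul S · n) (add_smul l l' m)).trans (add_tmul _ _ _)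
    | ha x y hx hy =>
      refine (map_add _ _ _).trans ((congrArg₂ (· + ·) hx hy).trans ?_)
      refine (add_add_add_comm _ _ _ _).trans ?_
      exact (congrArg₂ (· + ·) (map_add _ _ _) (map_add _ _ _)).symm
  zero_smul z := by
    induction z using induction_on with
    | h0 => exact map_zero _
    | ht m n =>
      exact (congrArg (tmul S · n) (zero_smul L m)).trans (zero_tmul n)
    | ha x y hx hy => exact (map_add _ _ _).trans ((congrArg₂ (· + ·) hx hy).trans (add_zero _))

theorem smul_tmul [Module L M] [SMulCommClass L Sᵐᵒᵖ M] (l : L) (m : M) (n : N) :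
    l • tmul S m n = tmul S (l • m) n := rfl

/-- The right `Q`-module `M ⊗_S N` for an `S`-`Q` bimodule `N`. -/
instance rightModule [Module Qᵐᵒᵖ N] [SMulCommClass S Qᵐᵒᵖ N] :
    Module Qᵐᵒᵖ (NCTensor S M N) where
  smul q := map LinearMap.id
    { toFun := fun n => q • n, map_add' := smul_add q,
      map_smul' := fun s n => (smul_comm s q n).symm }
  one_smul z := by
    induction z using induction_on with
    | h0 => exact map_zero _
    | ht m n => exact congrArg (tmul S m) (one_smul _ n)
    | ha x y hx hy => exact (map_add _ _ _).trans (congrArg₂ (· + ·) hx hy)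
  mul_smul l l' z := by
    induction z using induction_on with
    | h0 => exact (map_zero _).trans ((congrArg _ (map_zero _)).trans (map_zero _)).symm
    | ht m n => exact congrArg (tmul S m) (mul_smul l l' n)
    | ha x y hx hy =>
      exact (map_add _ _ _).trans ((congrArg₂ (· + ·) hx hy).trans
        ((congrArg _ (map_add _ _ _)).trans (map_add _ _ _)).symm)
  smul_zero l := map_zero _
  smul_add l := map_add _
  add_smul l l' z := by
    induction z using induction_on with
    | h0 =>
      refine (map_zero _).trans ?_
      exact ((congrArg₂ (· + ·) (map_zero _) (map_zero _)).trans (add_zero _)).symm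
    | ht m n => exact (congrArg (tmul S m) (add_smul l l' n)).trans (tmul_add _ _ _)
    | ha x y hx hy =>
      refine (map_add _ _ _).trans ((congrArg₂ (· + ·) hx hy).trans ?_)
      refine (add_add_add_comm _ _ _ _).trans ?_
      exact (congrArg₂ (· + ·) (map_add _ _ _) (map_add _ _ _)).symm
  zero_smul z := by
    induction z using induction_on with
    | h0 => exact map_zero _
    | ht m n =>
      exact (congrArg (tmul S m) (zero_smul _ n)).trans (tmul_zero m)
    | ha x y hx hy => exact (map_add _ _ _).trans ((congrArg₂ (· + ·) hx hy).trans (add_zero _))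

theorem op_smul_tmul [Module Qᵐᵒᵖ N] [SMulCommClass S Qᵐᵒᵖ N] (q : Qᵐᵒᵖ) (m : M) (n : N) :
    q • tmul S m n = tmul S m (q • n) := rfl

instance [Module L M] [SMulCommClass L Sᵐᵒᵖ M] [Module Qᵐᵒᵖ N] [SMulCommClass S Qᵐᵒᵖ N] :
    SMulCommClass L Qᵐᵒᵖ (NCTensor S M N) where
  smul_comm l q z := by
    induction z using induction_on with
    | h0 => simp only [smul_zero]
    | ht m n => simp only [smul_tmul, op_smul_tmul]
    | ha x y hx hy => simp only [smul_add, hx, hy]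

variable {P : Type*} [AddCommGroup P] [Module Qᵐᵒᵖ N] [SMulCommClass S Qᵐᵒᵖ N] [Module Q P]

/-- The map `m ⊗ n ↦ m ⊗ (n ⊗ p)`. -/
def assocHomAux (p : P) : NCTensor S M N →+ NCTensor S M (NCTensor Q N P) :=
  lift
    (AddMonoidHom.mk' (fun m => AddMonoidHom.mk' (fun n => tmul S m (tmul Q n p))
        (fun n n' => by rw [add_tmul, tmul_add]))
      (fun m m' => by ext n; exact add_tmul _ _ _))
    (fun m s n => by
      change tmul S (op s • m) (tmul Q n p) = tmul S m (tmul Q (s • n) p)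
      rw [tmul_balanced, smul_tmul])

/-- The forward direction of the associativity constraint. -/
def assocHom : NCTensor Q (NCTensor S M N) P →+ NCTensor S M (NCTensor Q N P) :=
  lift
    (AddMonoidHom.mk' (fun z => AddMonoidHom.mk' (fun p => assocHomAux p z)
        (fun p p' => by
          have h : (assocHomAux (p + p') : NCTensor S M N →+ NCTensor S M (NCTensor Q N P)) =
              assocHomAux p + assocHomAux p' := hom_ext fun m n => by
            change tmul S m (tmul Q n (p + p')) = tmul S m (tmul Q n p) + tmul S m (tmul Q n p')
            rw [tmul_add, tmul_add]
          rw [h]; rfl))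
      (fun z z' => by ext p; exact map_add (assocHomAux p) z z'))
    (fun z q p => by
      change assocHomAux p (op q • z) = assocHomAux (q • p) z
      induction z using induction_on with
      | h0 => rw [smul_zero, map_zero, map_zero]
      | ht m n =>
        change tmul S m (tmul Q (op q • n) p) = tmul S m (tmul Q n (q • p))
        rw [tmul_balanced]
      | ha x y hx hy => rw [smul_add, map_add, map_add, hx, hy])

/-- The map `n ⊗ p ↦ (m ⊗ n) ⊗ p`. -/
def assocInvAux (m : M) : NCTensor Q N P →+ NCTensor Q (NCTensor S M N) P :=
  lift
    (AddMonoidHom.mk' (fun n => AddMonoidHom.mk' (fun p => tmul Q (tmul S m n) p)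
        (fun p p' => by rw [tmul_add]))
      (fun n n' => by
        ext p
        change tmul Q (tmul S m (n + n')) p = tmul Q (tmul S m n) p + tmul Q (tmul S m n') p
        rw [tmul_add, add_tmul]))
    (fun n q p => by
      change tmul Q (tmul S m (op q • n)) p = tmul Q (tmul S m n) (q • p)
      rw [← tmul_balanced, op_smul_tmul])

/-- The backward direction of the associativity constraint. -/
def assocInv : NCTensor S M (NCTensor Q N P) →+ NCTensor Q (NCTensor S M N) P :=
  lift
    (AddMonoidHom.mk' (fun m => assocInvAux m)
      (fun m m' => hom_ext fun n p => by
        change tmul Q (tmul S (m + m') n) p = tmul Q (tmul S m n) p + tmul Q (tmul S m' n) p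
        rw [add_tmul, add_tmul]))
    (fun m s z => by
      change assocInvAux (op s • m) z = assocInvAux m (s • z)
      induction z using induction_on with
      | h0 => rw [smul_zero, map_zero, map_zero]
      | ht n p =>
        change tmul Q (tmul S (op s • m) n) p = tmul Q (tmul S m (s • n)) p
        rw [tmul_balanced]
      | ha x y hx hy => rw [smul_add, map_add, map_add, hx, hy])

/-- The associativity constraint `(M ⊗_S N) ⊗_Q P ≃ M ⊗_S (N ⊗_Q P)`. -/
def assoc : NCTensor Q (NCTensor S M N) P ≃+ NCTensor S M (NCTensor Q N P) :=
  AddMonoidHom.toAddEquiv assocHom assocInv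
    (hom_ext fun z p => by
      induction z using induction_on with
      | h0 => rw [zero_tmul, map_zero, map_zero]
      | ht m n => rfl
      | ha x y hx hy => rw [add_tmul, map_add, map_add, hx, hy])
    (hom_ext fun m z => by
      induction z using induction_on with
      | h0 => rw [tmul_zero, map_zero, map_zero]
      | ht n p => rfl
      | ha x y hx hy => rw [tmul_add, map_add, map_add, hx, hy])

@[simp] theorem assoc_tmul (m : M) (n : N) (p : P) :
    assoc (tmul Q (tmul S m n) p) = tmul S m (tmul Q n p) := rfl

@[simp] theorem assoc_symm_tmul (m : M) (n : N) (p : P) :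
    assoc.symm (tmul S m (tmul Q n p)) = tmul Q (tmul S m n) p := rfl

end modules

end NCTensor

/-! ## Bimodule maps, flatness, local projectivity -/

/-- An `L`-`Q` bimodule map. -/
structure BimoduleHom (L Q M N : Type*) [Ring L] [Ring Q] [AddCommGroup M] [AddCommGroup N]
    [Module L M] [Module Qᵐᵒᵖ M] [Module L N] [Module Qᵐᵒᵖ N] extends M →ₗ[L] N where
  map_op_smul' : ∀ (q : Qᵐᵒᵖ) (m : M), toFun (q • m) = q • toFun m

namespace BimoduleHom

variable {L Q M N : Type*} [Ring L] [Ring Q] [AddCommGroup M] [AddCommGroup N]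
  [Module L M] [Module Qᵐᵒᵖ M] [Module L N] [Module Qᵐᵒᵖ N]

instance : CoeFun (BimoduleHom L Q M N) (fun _ => M → N) := ⟨fun f => f.toLinearMap⟩

/-- The underlying left linear map. -/
abbrev left (f : BimoduleHom L Q M N) : M →ₗ[L] N := f.toLinearMap

/-- The underlying right linear map. -/
def right (f : BimoduleHom L Q M N) : M →ₗ[Qᵐᵒᵖ] N where
  toFun := f
  map_add' := f.left.map_add
  map_smul' := f.map_op_smul'

@[simp] theorem right_apply (f : BimoduleHom L Q M N) (m : M) : f.right m = f m := rfl

end BimoduleHom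

universe w in
/-- A left `S`-module `N` is flat if `- ⊗_S N` preserves injectivity of maps of right
`S`-modules. -/
def IsFlatLeftModule (S : Type*) (N : Type*) [Ring S] [AddCommGroup N] [Module S N] : Prop :=
  ∀ (M M' : Type w) [AddCommGroup M] [AddCommGroup M'] [Module Sᵐᵒᵖ M] [Module Sᵐᵒᵖ M']
    (f : M →ₗ[Sᵐᵒᵖ] M'), Function.Injective f →
      Function.Injective (NCTensor.map f (LinearMap.id : N →ₗ[S] N))

/-- A right `S`-module `M` is locally projective if for every finitely generated submodule `X`
there are finitely many `x_p ∈ M` and right `S`-linear functionals `ξ_p` on `M` with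
`x = ∑ x_p · ξ_p x` for all `x ∈ X`. -/
def IsLocallyProjectiveRightModule (S M : Type*) [Ring S] [AddCommGroup M] [Module Sᵐᵒᵖ M] :
    Prop :=
  ∀ X : Submodule Sᵐᵒᵖ M, X.FG →
    ∃ (n : ℕ) (x : Fin n → M) (ξ : Fin n → (M →ₗ[Sᵐᵒᵖ] S)),
      ∀ y ∈ X, y = ∑ p, op (ξ p y) • x p

/-! ## `R`-rings and the actions of a subalgebra -/

/-- An `R`-ring `A`, given by the ring map `η : R → A`. -/
class RRing (R A : Type*) [Ring R] [Ring A] where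
  /-- The unit map of the `R`-ring `A`. -/
  unit : R →+* A

namespace RRing

variable {R A : Type*} [Ring R] [Ring A] [RRing R A]

/-- `r · a = η r * a`. -/
instance : Module R A := Module.compHom A (RRing.unit : R →+* A)

/-- `a · r = a * η r`. -/
instance : Module Rᵐᵒᵖ A := Module.compHom A (RingHom.op (RRing.unit : R →+* A))

theorem smul_def (r : R) (a : A) : r • a = RRing.unit r * a := rfl

theorem op_smul_def (r : R) (a : A) : op r • a = a * RRing.unit r := rfl

instance : IsScalarTower R A A := ⟨fun _ a b => mul_assoc _ a b⟩

instance {L : Type*} [SMul L A] [IsScalarTower L A A] : SMulCommClass L Rᵐᵒᵖ A :=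
  ⟨fun l q a => (smul_mul_assoc l a (RRing.unit q.unop)).symm⟩

end RRing

section subalgebra

variable {k A : Type*} [CommRing k] [Ring A] [Algebra k A] (T : Subalgebra k A)

/-- The right action of a subalgebra `T` on `A`: `a · t = a * t`. -/
instance Subalgebra.rightModule : Module (↥T)ᵐᵒᵖ A :=
  Module.compHom A (RingHom.op T.val.toRingHom)

theorem Subalgebra.op_smul_eq (t : T) (a : A) : op t • a = a * t := rfl

instance {L : Type*} [SMul L A] [IsScalarTower L A A] : SMulCommClass L (↥T)ᵐᵒᵖ A :=
  ⟨fun l q a => (smul_mul_assoc l a (q.unop : A)).symm⟩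

end subalgebra

/-! ## Corings and comodules -/

/-- An `R`-coring: a comonoid in the category of `R`-`R` bimodules. -/
structure Coring (R C : Type*) [Ring R] [AddCommGroup C] [Module R C] [Module Rᵐᵒᵖ C]
    [SMulCommClass R Rᵐᵒᵖ C] where
  /-- The comultiplication. -/
  comul : BimoduleHom R R C (NCTensor R C C)
  /-- The counit. -/
  counit : BimoduleHom R R C R
  coassoc : ∀ c, NCTensor.assoc (NCTensor.map comul.right LinearMap.id (comul c)) =
    NCTensor.map LinearMap.id comul.left (comul c)
  counit_left : ∀ c, NCTensor.contractLeft counit.right (comul c) = c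
  counit_right : ∀ c, NCTensor.contractRight counit.left (comul c) = c

section comodules

variable {R C : Type*} [Ring R] [AddCommGroup C] [Module R C] [Module Rᵐᵒᵖ C]
  [SMulCommClass R Rᵐᵒᵖ C]

/-- A right comodule structure of the coring `C` on a right `R`-module `M`. -/
structure RightComodule (cC : Coring R C) (M : Type*) [AddCommGroup M] [Module Rᵐᵒᵖ M] where
  /-- The coaction `M → M ⊗_R C`. -/
  coact : M →ₗ[Rᵐᵒᵖ] NCTensor R M C
  coassoc : ∀ m, NCTensor.assoc (NCTensor.map coact LinearMap.id (coact m)) =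
    NCTensor.map LinearMap.id cC.comul.left (coact m)
  counit : ∀ m, NCTensor.contractRight cC.counit.left (coact m) = m

/-- A left comodule structure of the coring `C` on a left `R`-module `W`. -/
structure LeftComodule (cC : Coring R C) (W : Type*) [AddCommGroup W] [Module R W] where
  /-- The coaction `W → C ⊗_R W`. -/
  coact : W →ₗ[R] NCTensor R C W
  coassoc : ∀ x, NCTensor.assoc (NCTensor.map cC.comul.right LinearMap.id (coact x)) =
    NCTensor.map LinearMap.id coact (coact x)
  counit : ∀ x, NCTensor.contractLeft cC.counit.right (coact x) = x

/-- `e_{ij} = (C ⊗_R χ_j)(coaction of w_i)`. -/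
def LeftComodule.coeff {cC : Coring R C} {W : Type*} [AddCommGroup W] [Module R W]
    (cW : LeftComodule cC W) {I : Type*} (w : I → W) (χ : I → (W →ₗ[R] R)) (i j : I) : C :=
  NCTensor.contractRight (χ j) (cW.coact (w i))

/-! ## Entwining structures and entwined extensions -/

variable {A : Type*} [Ring A] [RRing R A]

/-- The right multiplication `(a ⊗ c) · a' = a ψ(c ⊗ a')` on `A ⊗_R C`, i.e. the composite
`(μ_A ⊗ C) ∘ (A ⊗ ψ)` evaluated at `(a ⊗ c) ⊗ a'`. -/
def entwinedMul (ψ : BimoduleHom R R (NCTensor R C A) (NCTensor R A C)) (a' : A) :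
    NCTensor R A C →+ NCTensor R A C :=
  NCTensor.lift
    (AddMonoidHom.mk' (fun a => AddMonoidHom.mk' (fun c => a • ψ (NCTensor.tmul R c a'))
        (fun c c' => by rw [NCTensor.add_tmul, map_add, smul_add]))
      (fun a b => by ext c; simp [add_smul]))
    (fun a r c => by
      have h : ψ (NCTensor.tmul R (r • c) a') = r • ψ (NCTensor.tmul R c a') := by
        rw [← NCTensor.smul_tmul, map_smul]
      change (a * RRing.unit r) • ψ (NCTensor.tmul R c a') =
        a • ψ (NCTensor.tmul R (r • c) a')
      rw [h, mul_smul]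
      generalize ψ (NCTensor.tmul R c a') = z
      induction z using NCTensor.induction_on with
      | h0 => simp only [smul_zero]
      | ht m n => rfl
      | ha x y hx hy => simp only [smul_add, hx, hy])

@[simp] theorem entwinedMul_tmul (ψ : BimoduleHom R R (NCTensor R C A) (NCTensor R A C))
    (a a' : A) (c : C) :
    entwinedMul ψ a' (NCTensor.tmul R a c) = a • ψ (NCTensor.tmul R c a') := rfl

theorem entwinedMul_smul (ψ : BimoduleHom R R (NCTensor R C A) (NCTensor R A C))
    (a a' : A) (z : NCTensor R A C) :
    entwinedMul ψ a' (a • z) = a • entwinedMul ψ a' z := by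
  induction z using NCTensor.induction_on with
  | h0 => simp only [smul_zero, map_zero]
  | ht m n => rw [NCTensor.smul_tmul, entwinedMul_tmul, entwinedMul_tmul, smul_eq_mul, mul_smul]
  | ha x y hx hy => simp only [smul_add, map_add, hx, hy]

/-- A right entwining structure `(A, C, ψ)` over `R`. -/
structure RightEntwining (cC : Coring R C) (A : Type*) [Ring A] [RRing R A] where
  /-- The entwining map `C ⊗_R A → A ⊗_R C`. -/
  psi : BimoduleHom R R (NCTensor R C A) (NCTensor R A C)
  /-- `ψ ∘ (C ⊗ μ) = (μ ⊗ C) ∘ (A ⊗ ψ) ∘ (ψ ⊗ A)`. -/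
  psi_mul : ∀ (c : C) (a a' : A), psi (NCTensor.tmul R c (a * a')) =
    entwinedMul psi a' (psi (NCTensor.tmul R c a))
  /-- `ψ ∘ (C ⊗ η) = η ⊗ C`. -/
  psi_one : ∀ c : C, psi (NCTensor.tmul R c 1) = NCTensor.tmul R 1 c
  /-- `(A ⊗ Δ) ∘ ψ = (ψ ⊗ C) ∘ (C ⊗ ψ) ∘ (Δ ⊗ A)`. -/
  psi_comul : ∀ z : NCTensor R C A,
    NCTensor.map LinearMap.id cC.comul.left (psi z) =
      NCTensor.assoc (NCTensor.map psi.right LinearMap.id (NCTensor.assoc.symm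
        (NCTensor.map LinearMap.id psi.left (NCTensor.assoc
          (NCTensor.map cC.comul.right LinearMap.id z)))))
  /-- `(A ⊗ ε) ∘ ψ = ε ⊗ A`. -/
  psi_counit : ∀ z : NCTensor R C A,
    NCTensor.contractRight cC.counit.left (psi z) = NCTensor.contractLeft cC.counit.right z

/-- A coaction making `A`, with its right regular action, a right entwined module. -/
structure EntwinedAlgebra {cC : Coring R C} (Ψ : RightEntwining cC A)
    extends RightComodule cC A where
  coact_mul : ∀ a a' : A, coact (a * a') = entwinedMul Ψ.psi a' (coact a)

namespace EntwinedAlgebra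

variable {cC : Coring R C} {Ψ : RightEntwining cC A} (cA : EntwinedAlgebra Ψ)

/-- The left coaction `a ↦ ψ⁻¹(a · ρ(1))` of `C` on `A`, for bijective `ψ`. -/
noncomputable def leftCoact (hψ : Function.Bijective Ψ.psi) (a : A) : NCTensor R C A :=
  (Equiv.ofBijective Ψ.psi hψ).symm (a • cA.coact 1)

theorem psi_leftCoact (hψ : Function.Bijective Ψ.psi) (a : A) :
    Ψ.psi (cA.leftCoact hψ a) = a • cA.coact 1 :=
  (Equiv.ofBijective Ψ.psi hψ).apply_symm_apply _

section coinvariants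

variable (k : Type*) [CommRing k] [Algebra k R] [Algebra k A] [IsScalarTower k R A]
  [Module k C] [IsScalarTower k R C] [IsScalarTower k Rᵐᵒᵖ C]

/-- The `k`-subalgebra `B = {b | ∀ a, ρ(b a) = b ρ(a)}` of coinvariants of `A`. -/
def coinvariants : Subalgebra k A where
  carrier := {b | ∀ a, cA.coact (b * a) = b • cA.coact a}
  mul_mem' {b b'} hb hb' a := by rw [mul_assoc, hb, hb', mul_smul]
  add_mem' {b b'} hb hb' a := by rw [add_mul, map_add, hb, hb', add_smul]
  algebraMap_mem' t a := by
    have hA : (RRing.unit (algebraMap k R t) : A) = algebraMap k A t := by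
      have h := smul_assoc t (1 : R) (1 : A)
      rwa [one_smul, ← Algebra.algebraMap_eq_smul_one, RRing.smul_def, mul_one,
        ← Algebra.algebraMap_eq_smul_one] at h
    have h1 : algebraMap k A t * a = op (algebraMap k R t) • a := by
      rw [RRing.op_smul_def, hA, Algebra.commutes]
    rw [h1, map_smul]
    generalize cA.coact a = z
    induction z using NCTensor.induction_on with
    | h0 => simp only [smul_zero]
    | ht m n =>
      have hC : op (algebraMap k R t) • n = algebraMap k R t • n := by
        have h2 := smul_assoc t (1 : R) n
        have h3 := smul_assoc t (1 : Rᵐᵒᵖ) n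
        rw [one_smul, ← Algebra.algebraMap_eq_smul_one] at h2 h3
        rw [h2, ← h3]; rfl
      rw [NCTensor.op_smul_tmul, hC, ← NCTensor.tmul_balanced, NCTensor.smul_tmul,
        RRing.op_smul_def, hA, smul_eq_mul, Algebra.commutes]
    | ha x y hx hy => simp only [smul_add, hx, hy]

/-- Equivalently, `b` is coinvariant if `ρ(b) = b ρ(1)`. -/
theorem mem_coinvariants_iff (b : A) :
    b ∈ cA.coinvariants k ↔ cA.coact b = b • cA.coact 1 := by
  refine ⟨fun h => by simpa using h 1, fun h a => ?_⟩
  rw [cA.coact_mul, h, entwinedMul_smul, ← cA.coact_mul, one_mul]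

variable {k}
variable {T : Subalgebra k A} (hT : T ≤ cA.coinvariants k)

/-- The right coaction of `A` as a left `T`-linear map, for `T ⊆ B`. -/
def coactLeftLinear : A →ₗ[T] NCTensor R A C where
  toFun := cA.coact
  map_add' := map_add _
  map_smul' t a := hT t.2 a

/-- The left coaction of `A` as a right `T`-linear map, for `T ⊆ B`. -/
noncomputable def leftCoactRightLinear (hψ : Function.Bijective Ψ.psi) :
    A →ₗ[(↥T)ᵐᵒᵖ] NCTensor R C A where
  toFun := cA.leftCoact hψ
  map_add' a a' := hψ.1 (by
    rw [map_add]; simp only [psi_leftCoact, add_smul])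
  map_smul' t a := hψ.1 (by
    have key : ∀ z : NCTensor R C A, Ψ.psi (t • z) = entwinedMul Ψ.psi (t.unop : A) (Ψ.psi z) := by
      intro z
      induction z using NCTensor.induction_on with
      | h0 => simp only [smul_zero, map_zero]
      | ht c b => exact Ψ.psi_mul c b _
      | ha x y hx hy => simp only [smul_add, map_add, hx, hy]
    rw [RingHom.id_apply, key, psi_leftCoact, psi_leftCoact, entwinedMul_smul, ← cA.coact_mul,
      one_mul]
    have h := hT t.unop.2 1
    rw [mul_one] at h
    rw [h]
    exact mul_smul a (t.unop : A) (cA.coact 1))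

/-- The right coaction `A ⊗_T ρ` of `C` on `A ⊗_T A`. -/
def rightCoactTensor : NCTensor T A A →+ NCTensor R (NCTensor T A A) C :=
  (NCTensor.assoc.symm : NCTensor T A (NCTensor R A C) ≃+ _).toAddMonoidHom.comp
    (NCTensor.map LinearMap.id (cA.coactLeftLinear hT))

/-- The left coaction of `C` on `A ⊗_T A` that is induced by the left coaction on the first
factor. -/
noncomputable def leftCoactTensor (hψ : Function.Bijective Ψ.psi) :
    NCTensor T A A →+ NCTensor R C (NCTensor T A A) :=
  (NCTensor.assoc : NCTensor T (NCTensor R C A) A ≃+ _).toAddMonoidHom.comp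
    (NCTensor.map (cA.leftCoactRightLinear hT hψ) LinearMap.id)

/-- The lifted canonical map `A ⊗_T A → A ⊗_R C`, `a ⊗ a' ↦ a ρ(a')`. -/
def canLift : NCTensor T A A →+ NCTensor R A C :=
  NCTensor.lift
    (AddMonoidHom.mk' (fun a => AddMonoidHom.mk' (fun a' => a • cA.coact a')
        (fun a' b' => by rw [map_add, smul_add]))
      (fun a b => by ext c; simp [add_smul]))
    (fun a t a' => by
      change (a * t) • cA.coact a' = a • cA.coact (t * a')
      rw [hT t.2 a', mul_smul])

/-- A strong `T`-connection: a left and right `C`-comodule map `ℓ : C → A ⊗_T A` with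
`can(ℓ c) = 1 ⊗ c`. -/
structure StrongConnection (hψ : Function.Bijective Ψ.psi) where
  /-- The underlying map, left and right `R`-linear. -/
  toHom : BimoduleHom R R C (NCTensor T A A)
  left_colinear : ∀ c, cA.leftCoactTensor hT hψ (toHom c) =
    NCTensor.map LinearMap.id toHom.left (cC.comul c)
  right_colinear : ∀ c, cA.rightCoactTensor hT (toHom c) =
    NCTensor.map toHom.right LinearMap.id (cC.comul c)
  canLift_apply : ∀ c, cA.canLift hT (toHom c) = NCTensor.tmul R 1 c

namespace StrongConnection

variable {cA hT} {hψ : Function.Bijective Ψ.psi} (ℓ : cA.StrongConnection hT hψ)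

/-- `ℓ_ξ = (ξ ⊗_T A) ∘ ℓ : C → A`, for a right `T`-linear functional `ξ` on `A`. -/
def component (ξ : A →ₗ[(↥T)ᵐᵒᵖ] T) : C →ₗ[Rᵐᵒᵖ] A where
  toFun c := NCTensor.contractLeft ξ (ℓ.toHom c)
  map_add' c c' := by simp
  map_smul' r c := by
    change NCTensor.contractLeft ξ (ℓ.toHom.right (r • c)) =
      r • NCTensor.contractLeft ξ (ℓ.toHom.right c)
    rw [map_smul]
    generalize ℓ.toHom.right c = z
    induction z using NCTensor.induction_on with
    | h0 => simp only [smul_zero, map_zero]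
    | ht m n => exact smul_comm (ξ m) r n
    | ha x y hx hy => simp only [smul_add, map_add, hx, hy]

end StrongConnection

variable (k) in
/-- The cotensor product `A □_C W`, the equaliser of `ρ ⊗ W` and `A ⊗ ρ` in `A ⊗_R W`, as a left
module over the algebra `B` of coinvariants. -/
def cotensor {W : Type*} [AddCommGroup W] [Module R W] (cW : LeftComodule cC W) :
    Submodule (cA.coinvariants k) (NCTensor R A W) where
  carrier := {z | NCTensor.assoc (NCTensor.map cA.coact LinearMap.id z) =
    NCTensor.map LinearMap.id cW.coact z}
  zero_mem' := by simp
  add_mem' {x y} hx hy := by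
    simp only [Set.mem_ofPred_eq, map_add] at hx hy ⊢
    rw [hx, hy]
  smul_mem' b z hz := by
    have h1 : ∀ z : NCTensor R A W,
        NCTensor.assoc (NCTensor.map cA.coact LinearMap.id (b • z)) =
          (b : A) • NCTensor.assoc (NCTensor.map cA.coact LinearMap.id z) := by
      intro z
      induction z using NCTensor.induction_on with
      | h0 => simp only [smul_zero, map_zero]
      | ht a v =>
        rw [NCTensor.smul_tmul, NCTensor.map_tmul, NCTensor.map_tmul]
        have : cA.coact (b • a) = (b : A) • cA.coact a := b.2 a
        rw [this]
        generalize cA.coact a = y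
        rw [← NCTensor.smul_tmul]
        generalize NCTensor.tmul R y (LinearMap.id (R := R) v) = u
        induction u using NCTensor.induction_on with
        | h0 => simp only [smul_zero, map_zero]
        | ht y v' =>
          induction y using NCTensor.induction_on with
          | h0 =>
            simp only [NCTensor.zero_tmul, smul_zero, map_zero]
          | ht m n => rfl
          | ha x y hx hy => simp only [NCTensor.add_tmul, smul_add, map_add, hx, hy]
        | ha x y hx hy => simp only [smul_add, map_add, hx, hy]
      | ha x y hx hy => simp only [smul_add, map_add, hx, hy]
    have h2 : ∀ z : NCTensor R A W, NCTensor.map LinearMap.id cW.coact (b • z) =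
        (b : A) • NCTensor.map LinearMap.id cW.coact z := by
      intro z
      induction z using NCTensor.induction_on with
      | h0 => simp only [smul_zero, map_zero]
      | ht a v => rfl
      | ha x y hx hy => simp only [smul_add, map_add, hx, hy]
    simp only [Set.mem_ofPred_eq] at hz ⊢
    rw [h1, h2, hz]

end coinvariants

end EntwinedAlgebra

end comodules

/-! The engine is a reconstruction formula. Write $\ell(c)=c^{(1)}\otimes_T c^{(2)}$ and
$\varrho(a)=a_0\otimes a_1$. Then every $a\in A$ satisfies
$a=\sum\phi(a_0\,a_1{}^{(1)})\,a_1{}^{(2)}$. Without $\phi$ this is immediate: multiplication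
$A\otimes_T A\to A$ equals $(A\otimes\varepsilon)\circ\widetilde{\mathrm{can}}_T$, and
$\widetilde{\mathrm{can}}_T(a_0\ell(a_1))=\varrho(a)$. The point is that $\phi$ may be inserted on
the first leg.

Since $\varrho(b)=b\varrho(1)$ characterises $B$, the subalgebra $B$ is the kernel of the difference
of the right $T$-linear maps $b\mapsto\psi^{-1}(\varrho(b))$ and ${}^A\!\varrho$. Applied to the
first leg of $a_0\ell(a_1)$, these two maps agree by left colinearity of $\ell$ and coassociativity
of $\varrho$. Flatness of $A$ over $T$ (`IsFlatLeftModule.map_eq_zero`) then shows that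
$\phi-\mathrm{id}$, which vanishes on $B$, kills $a_0\ell(a_1)$ as well. This is
`tensorMul_map_canSection_coact`.

An element $z=\sum_i a_i\otimes w_i$ of the cotensor product, with $a_i=(A\otimes\chi_i)(z)$,
satisfies $\varrho(a_j)=\sum_i a_i\otimes e_{ij}$. Expanding $\ell(e_{ij})=\sum_p
x_p\otimes\ell_p(e_{ij})$, the formula becomes $a_j=\sum_{i,p}\phi(a_ix_p)\,\ell_p(e_{ij})$. So
$f(z)=(\phi(a_ix_p))_{i,p}$ and $g(v)=\sum_{i,p,j} v_{ip}\,\ell_p(e_{ij})\otimes w_j$ satisfy $g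
f=\mathrm{id}$, while $B$-linearity of $\phi$ makes $f g$ right multiplication by $E$. Splitting
this idempotent gives the theorem. -/

namespace NCTensor

/-! ### Dual bases and functoriality for balanced tensor products -/

variable {S M N : Type*} [Ring S] [AddCommGroup M] [AddCommGroup N]
  [Module Sᵐᵒᵖ M] [Module S N]

theorem sum_tmul {ι : Type*} (s : Finset ι) (f : ι → M) (n : N) :
    tmul S (∑ i ∈ s, f i) n = ∑ i ∈ s, tmul S (f i) n :=
  map_sum (AddMonoidHom.mk' (fun m => tmul S m n) fun m m' => add_tmul m m' n) f s

theorem tmul_sum {ι : Type*} (s : Finset ι) (m : M) (f : ι → N) :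
    tmul S m (∑ i ∈ s, f i) = ∑ i ∈ s, tmul S m (f i) :=
  map_sum (AddMonoidHom.mk' (fun n => tmul S m n) fun n n' => tmul_add m n n') f s

/-- A dual basis of `N` expresses every element of `M ⊗_S N` through its contractions. -/
theorem eq_sum_contractRight_tmul {ι : Type*} [Fintype ι] {w : ι → N} {χ : ι → (N →ₗ[S] S)}
    (hw : ∀ v, v = ∑ i, χ i v • w i) (z : NCTensor S M N) :
    z = ∑ i, tmul S (contractRight (χ i) z) (w i) := by
  induction z using induction_on with
  | h0 => simp
  | ht m n =>
    conv_lhs => rw [hw n, tmul_sum]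
    exact Finset.sum_congr rfl fun i _ => by rw [contractRight_tmul, tmul_balanced]
  | ha x y hx hy =>
    simp only [map_add, add_tmul, Finset.sum_add_distrib]
    rw [← hx, ← hy]

theorem contractRight_smul {L : Type*} [Ring L] [Module L M] [SMulCommClass L Sᵐᵒᵖ M]
    (χ : N →ₗ[S] S) (l : L) (z : NCTensor S M N) :
    contractRight χ (l • z) = l • contractRight χ z := by
  induction z using induction_on with
  | h0 => simp only [smul_zero, map_zero]
  | ht m n => rw [smul_tmul, contractRight_tmul, contractRight_tmul,
      ← smul_comm l]
  | ha x y hx hy => simp only [smul_add, map_add, hx, hy]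

section comp

variable {M' M'' N' N'' : Type*} [AddCommGroup M'] [AddCommGroup N'] [Module Sᵐᵒᵖ M']
  [Module S N'] [AddCommGroup M''] [AddCommGroup N''] [Module Sᵐᵒᵖ M''] [Module S N'']

theorem map_map (f' : M' →ₗ[Sᵐᵒᵖ] M'') (f : M →ₗ[Sᵐᵒᵖ] M') (g' : N' →ₗ[S] N'') (g : N →ₗ[S] N')
    (z : NCTensor S M N) : map f' g' (map f g z) = map (f'.comp f) (g'.comp g) z := by
  induction z using induction_on with
  | h0 => simp only [map_zero]
  | ht m n => rfl
  | ha x y hx hy => simp only [map_add, hx, hy]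

theorem map_add_left (f f' : M →ₗ[Sᵐᵒᵖ] M') (g : N →ₗ[S] N') (z : NCTensor S M N) :
    map (f + f') g z = map f g z + map f' g z := by
  induction z using induction_on with
  | h0 => simp only [map_zero, add_zero]
  | ht m n => exact add_tmul _ _ _
  | ha x y hx hy => simp only [map_add, hx, hy]; abel

theorem map_sub_left (f f' : M →ₗ[Sᵐᵒᵖ] M') (g : N →ₗ[S] N') (z : NCTensor S M N) :
    map (f - f') g z = map f g z - map f' g z := by
  rw [eq_sub_iff_add_eq, ← map_add_left, sub_add_cancel]

end comp

end NCTensor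

-- Flatness and kernels

universe w in
/-- If `N` is flat and `g` vanishes on the kernel of `f`, then `g ⊗ N` vanishes on the kernel of
`f ⊗ N`. -/
theorem IsFlatLeftModule.map_eq_zero {S : Type*} {N : Type*} [Ring S] [AddCommGroup N]
    [Module S N] {M : Type*} {M' : Type w} {M'' : Type*} [AddCommGroup M] [AddCommGroup M']
    [AddCommGroup M''] [Module Sᵐᵒᵖ M] [Module Sᵐᵒᵖ M'] [Module Sᵐᵒᵖ M'']
    (hN : IsFlatLeftModule.{w} S N)
    (f : M →ₗ[Sᵐᵒᵖ] M') (g : M →ₗ[Sᵐᵒᵖ] M'') (hfg : LinearMap.ker f ≤ LinearMap.ker g)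
    (z : NCTensor S M N) (hz : NCTensor.map f LinearMap.id z = 0) :
    NCTensor.map g (LinearMap.id : N →ₗ[S] N) z = 0 := by
  -- The kernel inclusion lets `g` factor through the image of `f`.
  let h : LinearMap.range f →ₗ[Sᵐᵒᵖ] M'' :=
    ((LinearMap.ker f).liftQ g hfg).comp f.quotKerEquivRange.symm.toLinearMap
  have hg : h.comp f.rangeRestrict = g := by
    ext m
    change (LinearMap.ker f).liftQ g hfg (f.quotKerEquivRange.symm (f.rangeRestrict m)) = g m
    have : f.rangeRestrict m = f.quotKerEquivRange ((LinearMap.ker f).mkQ m) := rfl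
    rw [this, LinearEquiv.symm_apply_apply]
    rfl
  -- Flatness enters here: the inclusion of the image of `f` stays injective after tensoring, so `z`
  -- already dies in the tensor product with that image.
  have h0 : NCTensor.map f.rangeRestrict (LinearMap.id : N →ₗ[S] N) z = 0 := by
    apply hN _ _ (LinearMap.range f).subtype (Submodule.subtype_injective _)
    rw [NCTensor.map_map, map_zero]
    exact hz
  rw [← hg]
  have := NCTensor.map_map h f.rangeRestrict (LinearMap.id : N →ₗ[S] N) LinearMap.id z
  rw [h0, map_zero] at this
  exact this.symm

/-! ### The coefficient matrix of a comodule -/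

namespace LeftComodule

variable {R C : Type*} [Ring R] [AddCommGroup C] [Module R C] [Module Rᵐᵒᵖ C]
  [SMulCommClass R Rᵐᵒᵖ C] {cC : Coring R C} {W : Type*} [AddCommGroup W] [Module R W]
  (cW : LeftComodule cC W) {I : Type*} [Fintype I] {w : I → W} {χ : I → (W →ₗ[R] R)}

theorem coact_eq_sum_coeff (hw : ∀ v, v = ∑ i, χ i v • w i) (i : I) :
    cW.coact (w i) = ∑ j, NCTensor.tmul R (cW.coeff w χ i j) (w j) :=
  NCTensor.eq_sum_contractRight_tmul hw _

/-- The $w_i$ need not be a basis, so $\chi_j(w_m)$ need not be $\delta_{jm}$. This absorption rule,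
obtained by contracting the expansion of the coaction, replaces duality. -/
theorem sum_op_smul_coeff (hw : ∀ v, v = ∑ i, χ i v • w i) (i j : I) :
    ∑ m, op (χ j (w m)) • cW.coeff w χ i m = cW.coeff w χ i j := by
  conv_rhs => rw [coeff, cW.coact_eq_sum_coeff hw]
  simp

/-- Coassociativity of $W$ at $w_i$, with the last tensor factor contracted by $\chi_j$. -/
theorem comul_coeff (hw : ∀ v, v = ∑ i, χ i v • w i) (i j : I) :
    cC.comul (cW.coeff w χ i j) =
      ∑ m, NCTensor.tmul R (cW.coeff w χ i m) (cW.coeff w χ m j) := by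
  let κ : NCTensor R C (NCTensor R C W) →+ NCTensor R C C :=
    (NCTensor.contractRight (χ j)).comp
      (NCTensor.assoc (S := R) (Q := R) (M := C) (N := C) (P := W)).symm.toAddMonoidHom
  have h1 : ∀ z : NCTensor R C W,
      κ (NCTensor.assoc (NCTensor.map cC.comul.right LinearMap.id z)) =
        cC.comul (NCTensor.contractRight (χ j) z) := by
    intro z
    change NCTensor.contractRight (χ j) (NCTensor.assoc.symm (NCTensor.assoc _)) = _
    rw [AddEquiv.symm_apply_apply]
    induction z using NCTensor.induction_on with
    | h0 => simp only [map_zero]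
    | ht c v => exact (cC.comul.right.map_smul _ _).symm
    | ha x y hx hy => simp only [map_add, hx, hy]
  have h2 : ∀ (c : C) (z : NCTensor R C W),
      κ (NCTensor.tmul R c z) = NCTensor.tmul R c (NCTensor.contractRight (χ j) z) := by
    intro c z
    induction z using NCTensor.induction_on with
    | h0 => simp only [map_zero, NCTensor.tmul_zero]
    | ht d v => rfl
    | ha x y hx hy => simp only [map_add, NCTensor.tmul_add, hx, hy]
  rw [coeff, ← h1, cW.coassoc, cW.coact_eq_sum_coeff hw, map_sum, map_sum]
  exact Finset.sum_congr rfl fun m _ => by rw [NCTensor.map_tmul, h2]; rfl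

end LeftComodule

/-! ### The entwined right action and the coinvariants as an equaliser -/

namespace EntwinedAlgebra

variable {R : Type*} [Ring R] {A : Type uA} [Ring A] [RRing R A]
  {C : Type uC} [AddCommGroup C] [Module R C] [Module Rᵐᵒᵖ C] [SMulCommClass R Rᵐᵒᵖ C]
  {cC : Coring R C} {Ψ : RightEntwining cC A} {hψ : Function.Bijective Ψ.psi}
  {cA : EntwinedAlgebra Ψ}

theorem entwinedMul_mul (a a' : A) (s : NCTensor R A C) :
    entwinedMul Ψ.psi (a * a') s = entwinedMul Ψ.psi a' (entwinedMul Ψ.psi a s) := by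
  induction s using NCTensor.induction_on with
  | h0 => simp only [map_zero]
  | ht b c =>
    rw [entwinedMul_tmul, entwinedMul_tmul, Ψ.psi_mul, entwinedMul_smul]
  | ha x y hx hy => simp only [map_add, hx, hy]

theorem entwinedMul_add (a a' : A) (s : NCTensor R A C) :
    entwinedMul Ψ.psi (a + a') s = entwinedMul Ψ.psi a s + entwinedMul Ψ.psi a' s := by
  induction s using NCTensor.induction_on with
  | h0 => simp only [map_zero, add_zero]
  | ht b c =>
    rw [entwinedMul_tmul, entwinedMul_tmul, entwinedMul_tmul, NCTensor.tmul_add, map_add, smul_add]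
  | ha x y hx hy => simp only [map_add, hx, hy]; abel

/-- This balancing over $R$ is what makes `psiInvMulTensor` well defined. -/
theorem entwinedMul_op_smul (r : R) (a : A) (s : NCTensor R A C) :
    entwinedMul Ψ.psi a (op r • s) = entwinedMul Ψ.psi (r • a) s := by
  induction s using NCTensor.induction_on with
  | h0 => simp only [smul_zero, map_zero]
  | ht b c =>
    rw [NCTensor.op_smul_tmul, entwinedMul_tmul, entwinedMul_tmul, NCTensor.tmul_balanced]
  | ha x y hx hy => simp only [smul_add, map_add, hx, hy]

variable (hψ) in
/-- The inverse of the entwining map. -/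
noncomputable def psiInv : NCTensor R A C →+ NCTensor R C A :=
  (AddEquiv.ofBijective (Ψ.psi.left.toAddMonoidHom) hψ).symm.toAddMonoidHom

@[simp] theorem psi_psiInv (s : NCTensor R A C) : Ψ.psi (psiInv hψ s) = s :=
  (AddEquiv.ofBijective (Ψ.psi.left.toAddMonoidHom) hψ).apply_symm_apply s

@[simp] theorem psiInv_psi (z : NCTensor R C A) : psiInv hψ (Ψ.psi z) = z :=
  (AddEquiv.ofBijective (Ψ.psi.left.toAddMonoidHom) hψ).symm_apply_apply z

theorem leftCoact_eq_psiInv (a : A) : cA.leftCoact hψ a = psiInv hψ (a • cA.coact 1) := rfl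

variable {k : Type*} [CommRing k] [Algebra k A] {T : Subalgebra k A}

/-- By multiplicativity of $\psi$, right multiplication on $C\otimes_R A$ corresponds under $\psi$
to the entwined action on $A\otimes_R C$. -/
theorem psi_op_smul (t : (↥T)ᵐᵒᵖ) (z : NCTensor R C A) :
    Ψ.psi (t • z) = entwinedMul Ψ.psi (t.unop : A) (Ψ.psi z) := by
  induction z using NCTensor.induction_on with
  | h0 => simp only [smul_zero, map_zero]
  | ht c b => exact Ψ.psi_mul c b _
  | ha x y hx hy => simp only [smul_add, map_add, hx, hy]

variable (hψ T) in
/-- The right `T`-linear map `a ↦ ψ⁻¹(s · a)`. -/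
noncomputable def psiInvMul (s : NCTensor R A C) : A →ₗ[(↥T)ᵐᵒᵖ] NCTensor R C A where
  toFun a := psiInv hψ (entwinedMul Ψ.psi a s)
  map_add' a a' := by rw [entwinedMul_add, map_add]
  -- Linearity is tested after the injective map $\psi$, where it becomes associativity of the
  -- entwined action.
  map_smul' t a := hψ.1 (by
    rw [RingHom.id_apply, psi_op_smul, psi_psiInv, psi_psiInv]
    exact entwinedMul_mul a t.unop s)

theorem psiInvMul_apply (s : NCTensor R A C) (a : A) :
    psiInvMul hψ T s a = psiInv hψ (entwinedMul Ψ.psi a s) := rfl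

theorem psiInvMul_add (s s' : NCTensor R A C) :
    psiInvMul hψ T (s + s') = psiInvMul hψ T s + psiInvMul hψ T s' := by
  ext a
  simp [psiInvMul_apply]

variable (hψ T) in
/-- The left action of `A` on `A ⊗_R C`, transported to `C ⊗_R A`. -/
noncomputable def psiInvSMul (a : A) : NCTensor R C A →ₗ[(↥T)ᵐᵒᵖ] NCTensor R C A where
  toFun z := psiInv hψ (a • Ψ.psi z)
  map_add' z z' := by rw [map_add, smul_add, map_add]
  map_smul' t z := hψ.1 (by
    rw [RingHom.id_apply, psi_op_smul, psi_psiInv, psi_op_smul, psi_psiInv, entwinedMul_smul])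

/-- The right coaction followed by `ψ⁻¹`, as `a ↦ ψ⁻¹(ρ(1) · a)`. -/
theorem psiInvMul_coact_one (a : A) :
    psiInvMul hψ T (cA.coact 1) a = psiInv hψ (cA.coact a) := by
  rw [psiInvMul_apply, ← cA.coact_mul, one_mul]

variable (T) in
/-- The multiplication `A ⊗_T A → A`. -/
def tensorMul : NCTensor T A A →+ A :=
  NCTensor.lift (AddMonoidHom.mul : A →+ A →+ A) (fun a t a' => mul_assoc a t a')

@[simp] theorem tensorMul_tmul (a a' : A) : tensorMul T (NCTensor.tmul T a a') = a * a' := rfl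

variable [Algebra k R] [IsScalarTower k R A]
  [Module k C] [IsScalarTower k R C] [IsScalarTower k Rᵐᵒᵖ C] {hT : T ≤ cA.coinvariants k}

/-- The coinvariants are the equaliser of the two coactions. -/
theorem psiInvMul_coact_one_eq_leftCoact_iff (a : A) :
    psiInvMul hψ T (cA.coact 1) a = cA.leftCoact hψ a ↔ a ∈ cA.coinvariants k := by
  rw [psiInvMul_coact_one, leftCoact_eq_psiInv, mem_coinvariants_iff]
  exact ⟨fun h => by simpa using congrArg Ψ.psi h, fun h => by rw [h]⟩

/-- The counit axiom turns $a\varrho(a')$ into $aa'$. -/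
theorem tensorMul_eq_contractRight_canLift (z : NCTensor T A A) :
    tensorMul T z = NCTensor.contractRight cC.counit.left (cA.canLift hT z) := by
  induction z using NCTensor.induction_on with
  | h0 => simp only [map_zero]
  | ht a a' =>
    change a * a' = NCTensor.contractRight cC.counit.left (a • cA.coact a')
    rw [NCTensor.contractRight_smul, cA.counit, smul_eq_mul]
  | ha x y hx hy => simp only [map_add, hx, hy]

/-! ### Consequences of a strong connection -/

namespace StrongConnection

variable (ℓ : cA.StrongConnection hT hψ)

/-- Because $T\subseteq B$, the coaction $\varrho$ is left $T$-linear and so commutes with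
contraction by $\xi$. Contracting right colinearity of $\ell$ then gives the claim. -/
theorem coact_component (ξ : A →ₗ[(↥T)ᵐᵒᵖ] T) (c : C) :
    cA.coact (ℓ.component ξ c) =
      NCTensor.map (ℓ.component ξ) LinearMap.id (cC.comul c) := by
  let κ : NCTensor R (NCTensor T A A) C →+ NCTensor R A C :=
    (NCTensor.contractLeft ξ).comp
      (NCTensor.assoc (S := T) (Q := R) (M := A) (N := A) (P := C)).toAddMonoidHom
  have h1 : ∀ z : NCTensor T A A,
      κ (cA.rightCoactTensor hT z) = cA.coact (NCTensor.contractLeft ξ z) := by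
    intro z
    change NCTensor.contractLeft ξ (NCTensor.assoc (NCTensor.assoc.symm _)) = _
    rw [AddEquiv.apply_symm_apply]
    induction z using NCTensor.induction_on with
    | h0 => simp only [map_zero]
    | ht a b => exact ((cA.coactLeftLinear hT).map_smul _ _).symm
    | ha x y hx hy => simp only [map_add, hx, hy]
  have h2 : ∀ (z : NCTensor T A A) (c : C),
      κ (NCTensor.tmul R z c) = NCTensor.tmul R (NCTensor.contractLeft ξ z) c := by
    intro z c
    induction z using NCTensor.induction_on with
    | h0 => simp only [map_zero, NCTensor.zero_tmul]
    | ht a b => rfl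
    | ha x y hx hy => simp only [map_add, NCTensor.add_tmul, hx, hy]
  change cA.coact (NCTensor.contractLeft ξ (ℓ.toHom c)) = _
  rw [← h1, ℓ.right_colinear]
  generalize cC.comul c = u
  induction u using NCTensor.induction_on with
  | h0 => simp only [map_zero]
  | ht d d' => exact h2 _ _
  | ha x y hx hy => simp only [map_add, hx, hy]

/-- A dual family for the first legs of `ℓ c` recovers `ℓ c` from its components. -/
theorem apply_eq_sum_tmul_component {P ι : Type*} [Fintype P] [Fintype ι] (x : P → A)
    (ξ : P → (A →ₗ[(↥T)ᵐᵒᵖ] T)) (c : C) (y y' : ι → A)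
    (hy : ℓ.toHom c = ∑ ν, NCTensor.tmul T (y ν) (y' ν))
    (hx : ∀ ν, y ν = ∑ p, op (ξ p (y ν)) • x p) :
    ℓ.toHom c = ∑ p, NCTensor.tmul T (x p) (ℓ.component (ξ p) c) := by
  have hc : ∀ p, ℓ.component (ξ p) c = ∑ ν, ξ p (y ν) • y' ν := fun p => by
    change NCTensor.contractLeft (ξ p) (ℓ.toHom c) = _
    rw [hy, map_sum]
    rfl
  simp only [hc, NCTensor.tmul_sum]
  rw [hy, Finset.sum_comm]
  refine Finset.sum_congr rfl fun ν _ => ?_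
  conv_lhs => rw [hx ν, NCTensor.sum_tmul]
  exact Finset.sum_congr rfl fun p _ => NCTensor.tmul_balanced _ _ _

/-- The map `A ⊗_R C → A ⊗_T A`, `a ⊗ c ↦ a · ℓ c`, a section of the lifted canonical map. -/
def canSection : NCTensor R A C →+ NCTensor T A A :=
  NCTensor.lift
    (AddMonoidHom.mk' (fun a => AddMonoidHom.mk' (fun c => a • ℓ.toHom c)
        (fun c c' => by rw [map_add, smul_add]))
      (fun a b => by ext c; simp [add_smul]))
    (fun a r c => by
      change (a * RRing.unit r) • ℓ.toHom c = a • ℓ.toHom (r • c)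
      rw [map_smul, mul_smul]
      rfl)

@[simp] theorem canSection_tmul (a : A) (c : C) :
    ℓ.canSection (NCTensor.tmul R a c) = a • ℓ.toHom c := rfl

/-- The canonical map is left $A$-linear, so it suffices that it sends $\ell(c)$ to $1\otimes c$. -/
theorem canLift_canSection (s : NCTensor R A C) : cA.canLift hT (ℓ.canSection s) = s := by
  have h : ∀ (a : A) (z : NCTensor T A A), cA.canLift hT (a • z) = a • cA.canLift hT z := by
    intro a z
    induction z using NCTensor.induction_on with
    | h0 => simp only [smul_zero, map_zero]
    | ht b b' => exact mul_smul a b (cA.coact b')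
    | ha x y hx hy => simp only [smul_add, map_add, hx, hy]
  induction s using NCTensor.induction_on with
  | h0 => simp only [map_zero]
  | ht a c =>
    rw [canSection_tmul, h, ℓ.canLift_apply, NCTensor.smul_tmul, smul_eq_mul, mul_one]
  | ha x y hx hy => simp only [map_add, hx, hy]

theorem tensorMul_canSection_coact (a : A) : tensorMul T (ℓ.canSection (cA.coact a)) = a := by
  rw [tensorMul_eq_contractRight_canLift (cA := cA) (hT := hT), canLift_canSection, cA.counit]

/-- The map `s ⊗ c ↦ (ψ⁻¹(s · -) ⊗_T A)(ℓ c)`. -/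
noncomputable def psiInvMulTensor :
    NCTensor R (NCTensor R A C) C →+ NCTensor T (NCTensor R C A) A :=
  NCTensor.lift
    (AddMonoidHom.mk' (fun s => AddMonoidHom.mk'
        (fun c => NCTensor.map (psiInvMul hψ T s) LinearMap.id (ℓ.toHom c))
        (fun c c' => by rw [map_add, map_add]))
      (fun s s' => by ext c; simp [psiInvMul_add, NCTensor.map_add_left]))
    (fun s r c => by
      change NCTensor.map (psiInvMul hψ T (op r • s)) LinearMap.id (ℓ.toHom c) =
        NCTensor.map (psiInvMul hψ T s) LinearMap.id (ℓ.toHom (r • c))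
      rw [map_smul]
      generalize ℓ.toHom.left c = z
      induction z using NCTensor.induction_on with
      | h0 => simp only [smul_zero, map_zero]
      | ht a b =>
        rw [NCTensor.smul_tmul, NCTensor.map_tmul, NCTensor.map_tmul, psiInvMul_apply,
          psiInvMul_apply, entwinedMul_op_smul]
      | ha x y hx hy => simp only [smul_add, map_add, hx, hy])

theorem psiInvMulTensor_tmul (s : NCTensor R A C) (c : C) :
    ℓ.psiInvMulTensor (NCTensor.tmul R s c) =
      NCTensor.map (psiInvMul hψ T s) LinearMap.id (ℓ.toHom c) := rfl

/-- On first legs this is $\varrho(1)\cdot ab=\varrho(ab)=\varrho(a)\cdot b$ for the entwined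
action. The next result brings ${}^A\!\varrho$ to the same form, so that the two can be compared
through coassociativity. -/
theorem map_psiInvMul_coact_one_canSection (s : NCTensor R A C) :
    NCTensor.map (psiInvMul hψ T (cA.coact 1)) LinearMap.id (ℓ.canSection s) =
      ℓ.psiInvMulTensor (NCTensor.map cA.coact LinearMap.id s) := by
  induction s using NCTensor.induction_on with
  | h0 => simp only [map_zero]
  | ht a c =>
    rw [canSection_tmul, NCTensor.map_tmul, psiInvMulTensor_tmul, LinearMap.id_apply]
    generalize ℓ.toHom c = z
    induction z using NCTensor.induction_on with
    | h0 => simp only [smul_zero, map_zero]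
    | ht b b' =>
      rw [NCTensor.smul_tmul, NCTensor.map_tmul, NCTensor.map_tmul, psiInvMul_coact_one,
        psiInvMul_apply, ← cA.coact_mul, smul_eq_mul]
    | ha x y hx hy => simp only [smul_add, map_add, hx, hy]
  | ha x y hx hy => simp only [map_add, hx, hy]

/-- First ${}^A\!\varrho(ab)=\psi^{-1}(a\,\psi({}^A\!\varrho(b)))$. Left colinearity replaces
${}^A\!\varrho$ on the first leg of $\ell(c)$ by $c_1\otimes\ell(c_2)$, and $a\,\psi(c_1\otimes
b)=(a\otimes c_1)\cdot b$. -/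
theorem map_leftCoact_canSection (s : NCTensor R A C) :
    NCTensor.map (cA.leftCoactRightLinear hT hψ) LinearMap.id (ℓ.canSection s) =
      ℓ.psiInvMulTensor
        (NCTensor.assoc.symm (NCTensor.map LinearMap.id cC.comul.left s)) := by
  induction s using NCTensor.induction_on with
  | h0 => simp only [map_zero]
  | ht a c =>
    have h1 : ∀ z : NCTensor T A A,
        NCTensor.map (cA.leftCoactRightLinear hT hψ) LinearMap.id (a • z) =
          NCTensor.map (psiInvSMul hψ T a) LinearMap.id
            (NCTensor.assoc.symm (cA.leftCoactTensor hT hψ z)) := by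
      intro z
      change _ = NCTensor.map _ _ (NCTensor.assoc.symm (NCTensor.assoc _))
      rw [AddEquiv.symm_apply_apply, NCTensor.map_map]
      induction z using NCTensor.induction_on with
      | h0 => simp only [smul_zero, map_zero]
      | ht b b' =>
        refine congrArg (NCTensor.tmul T · b') ?_
        change psiInv hψ ((a * b) • cA.coact 1) = psiInv hψ (a • Ψ.psi (cA.leftCoact hψ b))
        rw [psi_leftCoact, mul_smul]
      | ha x y hx hy => simp only [smul_add, map_add, hx, hy]
    have h2 : ∀ (d : C) (z : NCTensor T A A),
        NCTensor.map (psiInvSMul hψ T a) LinearMap.id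
            (NCTensor.assoc.symm (NCTensor.tmul R d z)) =
          NCTensor.map (psiInvMul hψ T (NCTensor.tmul R a d)) LinearMap.id z := by
      intro d z
      induction z using NCTensor.induction_on with
      | h0 => simp only [NCTensor.tmul_zero, map_zero]
      | ht b b' => rfl
      | ha x y hx hy => simp only [NCTensor.tmul_add, map_add, hx, hy]
    rw [canSection_tmul, h1, ℓ.left_colinear, NCTensor.map_tmul]
    change _ = ℓ.psiInvMulTensor (NCTensor.assoc.symm (NCTensor.tmul R a (cC.comul c)))
    generalize cC.comul c = u
    induction u using NCTensor.induction_on with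
    | h0 => simp only [NCTensor.tmul_zero, map_zero]
    | ht d d' => exact h2 _ _
    | ha x y hx hy => simp only [NCTensor.tmul_add, map_add, hx, hy]
  | ha x y hx hy => simp only [map_add, hx, hy]

/-- If `A` is flat over `T`, a right `T`-linear retraction `g` of `A` onto the coinvariants fixes
the first leg of `a₀ ℓ(a₁)`. -/
theorem tensorMul_map_canSection_coact (hflat : IsFlatLeftModule.{max uA uC} T A)
    (g : A →ₗ[(↥T)ᵐᵒᵖ] A) (hg : ∀ b ∈ cA.coinvariants k, g b = b) (a : A) :
    tensorMul T (NCTensor.map g LinearMap.id (ℓ.canSection (cA.coact a))) = a := by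
  -- Both terms are `psiInvMulTensor` applied to the two sides of coassociativity of $\varrho$ at
  -- $a$.
  have hz : NCTensor.map (psiInvMul hψ T (cA.coact 1) - cA.leftCoactRightLinear hT hψ)
      LinearMap.id (ℓ.canSection (cA.coact a)) = 0 := by
    rw [NCTensor.map_sub_left, map_psiInvMul_coact_one_canSection, map_leftCoact_canSection,
      sub_eq_zero]
    congr 1
    rw [← cA.coassoc, AddEquiv.symm_apply_apply]
  -- The kernel of the difference is $B$, on which `g` is the identity.
  have h := hflat.map_eq_zero _ (g - LinearMap.id) (fun b hb => by
    rw [LinearMap.mem_ker, LinearMap.sub_apply, sub_eq_zero] at hb ⊢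
    exact hg b ((psiInvMul_coact_one_eq_leftCoact_iff b).1 hb)) _ hz
  have hid : ∀ z : NCTensor T A A, NCTensor.map LinearMap.id LinearMap.id z = z := by
    intro z
    induction z using NCTensor.induction_on with
    | h0 => simp only [map_zero]
    | ht b b' => rfl
    | ha x y hx hy => simp only [map_add, hx, hy]
  rw [NCTensor.map_sub_left, sub_eq_zero] at h
  rw [h, hid, tensorMul_canSection_coact]

end StrongConnection

/-! ### Coordinates on the cotensor product -/

variable {W : Type*} [AddCommGroup W] [Module R W] (cW : LeftComodule cC W)
  {I : Type*} [Fintype I] {w : I → W} {χ : I → (W →ₗ[R] R)}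

/-- The defining equation of the cotensor product, contracted by $\chi_j$ in the factor $W$. -/
theorem coact_contractRight_of_mem_cotensor (hw : ∀ v, v = ∑ i, χ i v • w i)
    {z : NCTensor R A W} (hz : z ∈ cA.cotensor k cW) (j : I) :
    cA.coact (NCTensor.contractRight (χ j) z) =
      ∑ i, NCTensor.tmul R (NCTensor.contractRight (χ i) z) (cW.coeff w χ i j) := by
  let κ : NCTensor R A (NCTensor R C W) →+ NCTensor R A C :=
    (NCTensor.contractRight (χ j)).comp
      (NCTensor.assoc (S := R) (Q := R) (M := A) (N := C) (P := W)).symm.toAddMonoidHom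
  have h1 : ∀ z : NCTensor R A W,
      κ (NCTensor.assoc (NCTensor.map cA.coact LinearMap.id z)) =
        cA.coact (NCTensor.contractRight (χ j) z) := by
    intro z
    change NCTensor.contractRight (χ j) (NCTensor.assoc.symm (NCTensor.assoc _)) = _
    rw [AddEquiv.symm_apply_apply]
    induction z using NCTensor.induction_on with
    | h0 => simp only [map_zero]
    | ht a v => exact (cA.coact.map_smul _ _).symm
    | ha x y hx hy => simp only [map_add, hx, hy]
  have h2 : ∀ (a : A) (u : NCTensor R C W),
      κ (NCTensor.tmul R a u) = NCTensor.tmul R a (NCTensor.contractRight (χ j) u) := by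
    intro a u
    induction u using NCTensor.induction_on with
    | h0 => simp only [map_zero, NCTensor.tmul_zero]
    | ht c v => rfl
    | ha x y hx hy => simp only [map_add, NCTensor.tmul_add, hx, hy]
  have hz' : NCTensor.assoc (NCTensor.map cA.coact LinearMap.id z) =
    NCTensor.map LinearMap.id cW.coact z := hz
  rw [← h1, hz']
  conv_lhs => rw [NCTensor.eq_sum_contractRight_tmul hw z, map_sum, map_sum]
  exact Finset.sum_congr rfl fun i _ => by rw [NCTensor.map_tmul, h2]; rfl

/-- A right colinear map `f : C → A` sends the rows of coefficients of `W` into the cotensor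
product. -/
theorem sum_tmul_mem_cotensor (hw : ∀ v, v = ∑ i, χ i v • w i) (f : C →ₗ[Rᵐᵒᵖ] A)
    (hf : ∀ c, cA.coact (f c) = NCTensor.map f LinearMap.id (cC.comul c)) (i : I) :
    ∑ j, NCTensor.tmul R (f (cW.coeff w χ i j)) (w j) ∈ cA.cotensor k cW := by
  change NCTensor.assoc (NCTensor.map cA.coact LinearMap.id _) = NCTensor.map LinearMap.id cW.coact _
  simp only [map_sum, NCTensor.map_tmul, hf, cW.comul_coeff hw, LinearMap.id_apply,
    NCTensor.sum_tmul, NCTensor.assoc_tmul, cW.coact_eq_sum_coeff hw, NCTensor.tmul_sum]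
  exact Finset.sum_comm

variable (k) in
/-- The coordinates `z ↦ φ((A ⊗ χ_i)(z) · x_p)` on the cotensor product. -/
def cotensorCoord {P : Type*} (φ : A →ₗ[cA.coinvariants k] cA.coinvariants k)
    (χ : I → (W →ₗ[R] R)) (x : P → A) :
    cA.cotensor k cW →ₗ[cA.coinvariants k] (I × P → cA.coinvariants k) where
  toFun z ip := φ (NCTensor.contractRight (χ ip.1) (z : NCTensor R A W) * x ip.2)
  map_add' z z' := by
    ext ip
    simp [add_mul]
  map_smul' b z := by
    ext1 ip
    have h : NCTensor.contractRight (χ ip.1) ((b • z : cA.cotensor k cW) : NCTensor R A W) =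
        b • NCTensor.contractRight (χ ip.1) (z : NCTensor R A W) :=
      NCTensor.contractRight_smul _ _ _
    rw [h, smul_mul_assoc, map_smul]
    rfl

variable (k) in
/-- The row combination `v ↦ ∑ v_{(i,p)} f_p(e_{ij}) ⊗ w_j` in the cotensor product. -/
def cotensorCombination {P : Type*} [Fintype P] (hw : ∀ v, v = ∑ i, χ i v • w i)
    (f : P → (C →ₗ[Rᵐᵒᵖ] A))
    (hf : ∀ p c, cA.coact (f p c) = NCTensor.map (f p) LinearMap.id (cC.comul c)) :
    (I × P → cA.coinvariants k) →ₗ[cA.coinvariants k] cA.cotensor k cW :=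
  Fintype.linearCombination (cA.coinvariants k)
    fun ip : I × P => (⟨_, sum_tmul_mem_cotensor cW hw (f ip.2) (hf ip.2) ip.1⟩ : cA.cotensor k cW)

end EntwinedAlgebra

/-! ### Splitting an idempotent matrix, and the main theorem -/

/-- If `f` and `g` satisfy `g ∘ f = id` and `f ∘ g` is right multiplication by `E`, then `E` is
idempotent and its row module is isomorphic to the source of `f`. -/
theorem Matrix.isIdempotentElem_and_nonempty_equiv_range_vecMulLinear {B M ι : Type*} [Ring B]
    [AddCommGroup M] [Module B M] [Fintype ι] (E : Matrix ι ι B) (f : M →ₗ[B] (ι → B))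
    (g : (ι → B) →ₗ[B] M) (hgf : ∀ m, g (f m) = m) (hfg : ∀ v, f (g v) = Matrix.vecMul v E) :
    IsIdempotentElem E ∧ Nonempty (M ≃ₗ[B] LinearMap.range (Matrix.vecMulLinear E)) := by
  classical
  constructor
  · refine Matrix.ext_of_single_vecMul fun i => ?_
    rw [← Matrix.vecMul_vecMul, ← hfg, ← hfg, hgf]
  · have hr : LinearMap.range f = LinearMap.range (Matrix.vecMulLinear E) := by
      ext v
      constructor
      · rintro ⟨m, rfl⟩
        exact ⟨f m, by rw [Matrix.vecMulLinear_apply, ← hfg, hgf]⟩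
      · rintro ⟨u, rfl⟩
        exact ⟨g u, by rw [hfg, Matrix.vecMulLinear_apply]⟩
    exact ⟨(LinearEquiv.ofInjective f (Function.LeftInverse.injective hgf)).trans
      (LinearEquiv.ofEq _ _ hr)⟩

theorem theorem5
    -- the ground ring `k`, the `k`-algebra `R`, the `R`-ring `A`
    {k : Type uk} [CommRing k] {R : Type uR} [Ring R] [Algebra k R]
    {A : Type uA} [Ring A] [Algebra k A] [RRing R A] [IsScalarTower k R A]
    -- the `R`-coring `C`, whose two `k`-actions coincide
    {C : Type uC} [AddCommGroup C] [Module R C] [Module Rᵐᵒᵖ C] [SMulCommClass R Rᵐᵒᵖ C]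
    [Module k C] [IsScalarTower k R C] [IsScalarTower k Rᵐᵒᵖ C] (cC : Coring R C)
    -- a bijective right entwining structure and the entwined extension `B ⊆ A`
    (Ψ : RightEntwining cC A) (hψ : Function.Bijective Ψ.psi) (cA : EntwinedAlgebra Ψ)
    (T : Subalgebra k A) (hT : T ≤ cA.coinvariants k)
    -- `φ` is a `B`-`T` bimodule retraction of the inclusion `B ⊆ A`
    (φ : A →ₗ[cA.coinvariants k] cA.coinvariants k)
    (hφT : ∀ (a : A) (t : T), φ (a * t) = φ a * ⟨t, hT t.2⟩)
    (hφ : ∀ b : cA.coinvariants k, φ b = b)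
    (hloc : IsLocallyProjectiveRightModule T A)
    (hflat : IsFlatLeftModule.{max uA uC} T A)
    (ℓ : cA.StrongConnection hT hψ)
    -- the left comodule `W` with a finite dual basis
    {W : Type uW} [AddCommGroup W] [Module R W] [Module.Finite R W] [Module.Projective R W]
    (cW : LeftComodule cC W)
    {I : Type uI} [Fintype I] (w : I → W) (χ : I → (W →ₗ[R] R))
    (hw : ∀ v : W, v = ∑ i, χ i v • w i)
    -- representatives of `ℓ(e_{ij})`; their first legs span the right `T`-module `X`
    (n : ℕ) (y y' : I → I → Fin n → A)
    (hy : ∀ i j, ℓ.toHom (cW.coeff w χ i j) = ∑ ν, NCTensor.tmul T (y i j ν) (y' i j ν))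
    {P : Type uP} [Fintype P] (x : P → A) (ξ : P → (A →ₗ[(↥T)ᵐᵒᵖ] T))
    (hx : ∀ a ∈ Submodule.span (↥T)ᵐᵒᵖ {a | ∃ i j ν, a = y i j ν}, a = ∑ p, op (ξ p a) • x p)
    (E : Matrix (I × P) (I × P) (cA.coinvariants k))
    (hE : ∀ i p j q, E (i, p) (j, q) = φ (ℓ.component (ξ p) (cW.coeff w χ i j) * x q)) :
    -- the maps `ℓ_p` are right `C`-comodule maps
    (∀ p c, cA.coact (ℓ.component (ξ p) c) =
      NCTensor.map (ℓ.component (ξ p)) LinearMap.id (cC.comul c)) ∧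
    IsIdempotentElem E ∧
    Nonempty (cA.cotensor k cW ≃ₗ[cA.coinvariants k] LinearMap.range (Matrix.vecMulLinear E)) := by
  have hℓ := fun p => ℓ.coact_component (ξ p)
  refine ⟨hℓ, Matrix.isIdempotentElem_and_nonempty_equiv_range_vecMulLinear E
    (EntwinedAlgebra.cotensorCoord k cW φ χ x)
    (EntwinedAlgebra.cotensorCombination k cW hw (fun p => ℓ.component (ξ p)) hℓ) ?_ ?_⟩
  · intro z
    -- The retraction $\phi$ viewed as a right $T$-linear endomorphism of $A$.
    let g : A →ₗ[(↥T)ᵐᵒᵖ] A :=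
      { toFun := fun a => (φ a : A)
        map_add' := fun a b => by rw [map_add]; rfl
        map_smul' := fun t a => congrArg Subtype.val (hφT a t.unop) }
    have hE' : ∀ i j, ℓ.toHom (cW.coeff w χ i j) =
        ∑ p, NCTensor.tmul T (x p) (ℓ.component (ξ p) (cW.coeff w χ i j)) := fun i j =>
      ℓ.apply_eq_sum_tmul_component x ξ _ _ _ (hy i j) fun ν =>
        hx _ (Submodule.subset_span ⟨i, j, ν, rfl⟩)
    -- The reconstruction formula for $a_j=(A\otimes\chi_j)(z)$, with $\varrho(a_j)$ and
    -- $\ell(e_{ij})$ expanded.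
    have key : ∀ j, NCTensor.contractRight (χ j) (z : NCTensor R A W) =
        ∑ ip : I × P, (φ (NCTensor.contractRight (χ ip.1) (z : NCTensor R A W) * x ip.2) : A) *
          ℓ.component (ξ ip.2) (cW.coeff w χ ip.1 j) := by
      intro j
      have h := ℓ.tensorMul_map_canSection_coact hflat g
        (fun b hb => congrArg Subtype.val (hφ ⟨b, hb⟩))
        (NCTensor.contractRight (χ j) (z : NCTensor R A W))
      rw [EntwinedAlgebra.coact_contractRight_of_mem_cotensor cW hw z.2 j] at h
      rw [Fintype.sum_prod_type, ← h]
      simp only [map_sum, EntwinedAlgebra.StrongConnection.canSection_tmul, hE', Finset.smul_sum,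
        NCTensor.smul_tmul, NCTensor.map_tmul, EntwinedAlgebra.tensorMul_tmul]
      rfl
    apply Subtype.ext
    conv_rhs => rw [NCTensor.eq_sum_contractRight_tmul hw (z : NCTensor R A W)]
    rw [Finset.sum_congr rfl fun j _ => by rw [key j, NCTensor.sum_tmul], Finset.sum_comm,
      EntwinedAlgebra.cotensorCombination, Fintype.linearCombination_apply,
      AddSubmonoidClass.coe_finsetSum]
    refine Finset.sum_congr rfl fun ip _ => ?_
    rw [Submodule.coe_smul, Finset.smul_sum]
    rfl
  · intro v
    ext1 ⟨j, q⟩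
    -- Right $R$-linearity of $\ell_p$ carries the absorption rule for $e_{ij}$ over to
    -- $\ell_p(e_{ij})$.
    have h : ∀ ip : I × P, NCTensor.contractRight (χ j)
        (∑ m, NCTensor.tmul R (ℓ.component (ξ ip.2) (cW.coeff w χ ip.1 m)) (w m)) =
          ℓ.component (ξ ip.2) (cW.coeff w χ ip.1 j) := by
      intro ip
      rw [← cW.sum_op_smul_coeff hw ip.1 j]
      simp only [map_sum, map_smul, NCTensor.contractRight_tmul]
    rw [EntwinedAlgebra.cotensorCombination, Fintype.linearCombination_apply, map_sum,
      Finset.sum_apply]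
    refine Finset.sum_congr rfl fun ip _ => ?_
    have hEip : E ip (j, q) = φ (ℓ.component (ξ ip.2) (cW.coeff w χ ip.1 j) * x q) :=
      hE ip.1 ip.2 j q
    rw [map_smul, Pi.smul_apply, smul_eq_mul]
    refine congrArg (v ip * ·) ?_
    refine Eq.trans ?_ hEip.symm
    rw [← h ip]
    rfl
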